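/- Identify the plane with $\mathbb{R}^2=\mathbb{C}$ and let $G_3$ be the group of planar motions generated by all translations and the rotations by multiples of $2\pi/3$. A set $K\subseteq\mathbb{R}^2$ is a $G_3$-covering of the closed curves of length $2$ if for every closed curve $\gamma$ of length $2$ there is $g\in G_3$ with $g\gamma\subseteq K$. Let $$\Gamma_3=\{(x,y)\in\mathbb{R}^2 : y^2\le 1+2x,\ y^2\le 1-2x,\ 0\le y\le 2/3\},$$ and let $|\cdot|$ denote area (Lebesgue measure, possibly $+\infty$). Let $K$ be a convex $G_3$-covering of the closed curves of length $2$. 1. If $K$ is invariant under the rotation by $2\pi/3$ about some point of the plane, then $|K|\ge \sqrt3/3$ and $|K|>|\Gamma_3|$. 2. If $K$ is invariant under the rotation by $\pi/2$ about some point of the plane, then $|K|\ge \sqrt6/4$ and $|K|>|\Gamma_3|$. -/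

import Mathlib

/-! The Euclidean plane is `ℂ`, with its standard metric and Lebesgue measure (`volume`). -/

noncomputable section

/-- The group `G_k = T ⋊ Z_k` of planar motions generated by all translations and the rotations
by the multiples of `2π/k`: the maps `z ↦ e^{2πij/k} z + v`. -/
def discreteMotionGroup (k : ℕ) : Subgroup (ℂ ≃ᵢ ℂ) where
  carrier := {g | ∃ (j : ℤ) (v : ℂ), ∀ z : ℂ,
    g z = Complex.exp ((2 * Real.pi * j / k : ℝ) * Complex.I) * z + v}
  mul_mem' := by
    rintro g h ⟨j, v, hg⟩ ⟨j', v', hh⟩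
    refine ⟨j + j', Complex.exp ((2 * Real.pi * j / k : ℝ) * Complex.I) * v' + v, fun z => ?_⟩
    have e : Complex.exp ((2 * Real.pi * ((j + j' : ℤ) : ℝ) / k : ℝ) * Complex.I)
        = Complex.exp ((2 * Real.pi * j / k : ℝ) * Complex.I)
          * Complex.exp ((2 * Real.pi * j' / k : ℝ) * Complex.I) := by
      rw [← Complex.exp_add]
      congr 1
      push_cast
      ring
    rw [IsometryEquiv.mul_apply, hg, hh, e]
    ring
  one_mem' := ⟨0, 0, fun z => by simp⟩
  inv_mem' := by
    rintro g ⟨j, v, hg⟩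
    refine ⟨-j, -(Complex.exp ((2 * Real.pi * ((-j : ℤ) : ℝ) / k : ℝ) * Complex.I) * v),
      fun z => ?_⟩
    have e : Complex.exp ((2 * Real.pi * ((-j : ℤ) : ℝ) / k : ℝ) * Complex.I)
        * Complex.exp ((2 * Real.pi * j / k : ℝ) * Complex.I) = 1 := by
      rw [← Complex.exp_add, ← Complex.exp_zero]
      congr 1
      push_cast
      ring
    have hz : g (g⁻¹ z) = z := IsometryEquiv.apply_inv_self g z
    rw [hg] at hz
    linear_combination Complex.exp ((2 * Real.pi * ((-j : ℤ) : ℝ) / k : ℝ) * Complex.I) * hz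
      - (g⁻¹ z) * e

/-- `K` is a `G`-covering of the family `S` of planar objects: every object of `S` is moved into
`K` by some element of `G`. -/
def IsCovering (G : Subgroup (ℂ ≃ᵢ ℂ)) (S : Set (Set ℂ)) (K : Set ℂ) : Prop :=
  ∀ A ∈ S, ∃ g ∈ G, g '' A ⊆ K

/-- The (point sets of) closed curves of length `ℓ` in the plane. -/
def closedCurvesOfLength (ℓ : ℝ) : Set (Set ℂ) :=
  {A | ∃ γ : ℝ → ℂ, ContinuousOn γ (Set.Icc 0 1) ∧ γ 0 = γ 1 ∧
    eVariationOn γ (Set.Icc 0 1) = ENNReal.ofReal ℓ ∧ A = γ '' Set.Icc 0 1}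

/-- `K` is regular under rotation by the angle `θ`: it is mapped onto itself by the rotation by
`θ` about some point `c` of the plane. -/
def IsRegularUnderRotation (θ : ℝ) (K : Set ℂ) : Prop :=
  ∃ c : ℂ, (fun z : ℂ => c + Complex.exp (θ * Complex.I) * (z - c)) '' K = K

/-- The region `Γ₃`: the part between the lines `y = 0` and `y = 2/3` of the convex region that
is bounded by the parabolas `y² = 1 + 2x` and `y² = 1 - 2x` and contains the origin. -/
def Gamma3 : Set ℂ :=
  {z | z.im ^ 2 ≤ 1 + 2 * z.re ∧ z.im ^ 2 ≤ 1 - 2 * z.re ∧ 0 ≤ z.im ∧ z.im ≤ 2 / 3}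

end

/-! ### Unit segments in a covering, and the area of `Gamma3` -/

section PlanarArea

open MeasureTheory

/-! The only closed curves needed are unit segments traversed twice: for every unit `u`, `K`
contains a unit segment in one of the directions `u`, `ωu`, `ω²u` (`exists_unit_segment`). Put the
centre of rotation at `0`. Given points `a` and `p = s a + t ρa` of `K` with `s, t > 0`, the
triangles `0, a, p` and `0, p, ρa` lie in one sector, and the rotated copies of that sector are
disjoint, so `K` has at least `n` times their joint area (`le_volume_of_rotation_of_mem`).

Quarter turn: central symmetry moves the segments to the centre, giving points at distance `1/2`
from `0` in suitable directions. Two of them make an angle of `π/12`, `3π/12` or `5π/12`, and the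
resulting octagonal area is at least `√6/4`.

Third of a turn: `K` has unit segments in all directions. Let `r` be the radius of the largest disc
about `0`, touching a supporting line with normal `u`. If `r ≥ 1/2` the disc suffices. Otherwise a
unit segment in direction `u` has an endpoint `p` at depth at least `1 - r` on the far side of `0`;
with the rotated contact points it yields area at least `(3√3/2) r (1 - r)`. The rotated supporting
lines force `r ≥ 1/3`, and `r (1 - r) ≥ 2/9` on `[1/3, 2/3]`.

Both bounds exceed `46/81`, the area of `Gamma3`. -/

theorem lipschitzWith_doubledSegment {u : ℂ} (hu : ‖u‖ = 1) :
    LipschitzWith 2 (fun t : ℝ => ((1 - |2 * t - 1| : ℝ) : ℂ) * u) := by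
  refine LipschitzWith.of_dist_le_mul fun x y => ?_
  rw [dist_eq_norm, ← sub_mul, norm_mul, hu, mul_one, ← Complex.ofReal_sub, Complex.norm_real,
    Real.norm_eq_abs, Real.dist_eq]
  have h := abs_abs_sub_abs_le_abs_sub (2 * y - 1) (2 * x - 1)
  have e : |2 * y - 1 - (2 * x - 1)| = 2 * |x - y| := by
    rw [show 2 * y - 1 - (2 * x - 1) = 2 * (y - x) by ring, abs_mul, abs_sub_comm]; norm_num
  rw [e] at h
  calc _ = |(|2 * y - 1| - |2 * x - 1|)| := by congr 1; ring
    _ ≤ _ := by simpa using h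

theorem eVariationOn_doubledSegment {u : ℂ} (hu : ‖u‖ = 1) :
    eVariationOn (fun t : ℝ => ((1 - |2 * t - 1| : ℝ) : ℂ) * u) (Set.Icc 0 1)
      = ENNReal.ofReal 2 := by
  set γ : ℝ → ℂ := fun t : ℝ => ((1 - |2 * t - 1| : ℝ) : ℂ) * u with hγ
  have h0 : γ 0 = 0 := by simp [hγ]
  have h1 : γ 1 = 0 := by simp only [hγ]; norm_num
  have h2 : γ (1 / 2) = u := by simp [hγ]
  apply le_antisymm
  · have h := (lipschitzWith_doubledSegment hu).lipschitzOnWith (s := Set.univ)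
      |>.comp_eVariationOn_le (g := fun t : ℝ => t) (s := Set.Icc (0 : ℝ) 1)
        (fun _ _ => Set.mem_univ _)
    have hm : eVariationOn (fun t : ℝ => t) (Set.Icc (0 : ℝ) 1 ∩ Set.Icc 0 1)
        ≤ ENNReal.ofReal (1 - 0) :=
      ((monotone_id.monotoneOn _).eVariationOn_eq (by simp) (by simp)).le
    rw [Set.inter_self] at hm
    calc _ ≤ _ := h
      _ ≤ ((2 : NNReal) : ENNReal) * ENNReal.ofReal (1 - 0) := by gcongr
      _ = _ := by norm_num
  · have hs := eVariationOn.Icc_add_Icc γ (s := Set.univ) (a := 0) (b := 1 / 2) (c := 1)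
      (by norm_num) (by norm_num) (Set.mem_univ _)
    simp only [Set.univ_inter] at hs
    rw [← hs]
    have e1 := eVariationOn.edist_le γ (s := Set.Icc (0 : ℝ) (1 / 2)) (x := 0) (y := 1 / 2)
      (by simp) (by simp)
    have e2 := eVariationOn.edist_le γ (s := Set.Icc (1 / 2 : ℝ) 1) (x := 1 / 2) (y := 1)
      (by norm_num) (by norm_num)
    rw [h0, h2, edist_dist, dist_zero_left, hu, ENNReal.ofReal_one] at e1
    rw [h2, h1, edist_dist, dist_zero_right, hu, ENNReal.ofReal_one] at e2
    calc ENNReal.ofReal 2 = 1 + 1 := by norm_num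
      _ ≤ _ := add_le_add e1 e2

/-- The primitive cube root of unity `e^{2πi/3}`. -/
noncomputable def omega : ℂ := Complex.exp ((2 * Real.pi / 3 : ℝ) * Complex.I)

theorem omega_eq : omega = ⟨-1 / 2, √3 / 2⟩ := by
  have h : (2 * Real.pi / 3 : ℝ) = Real.pi - Real.pi / 3 := by ring
  apply Complex.ext
  · rw [omega, Complex.exp_ofReal_mul_I_re, h, Real.cos_pi_sub, Real.cos_pi_div_three]; norm_num
  · rw [omega, Complex.exp_ofReal_mul_I_im, h, Real.sin_pi_sub, Real.sin_pi_div_three]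

theorem omega_pow_three : omega ^ 3 = 1 := by
  rw [omega, ← Complex.exp_nat_mul, ← Complex.exp_two_pi_mul_I]
  congr 1; push_cast; ring

theorem exists_omega_pow_eq (j : ℤ) :
    ∃ m : ℕ, m < 3 ∧ Complex.exp ((2 * Real.pi * j / (3 : ℕ) : ℝ) * Complex.I) = omega ^ m := by
  obtain ⟨m, hm⟩ := Int.eq_ofNat_of_zero_le (Int.emod_nonneg j (by norm_num : (3 : ℤ) ≠ 0))
  have hlt := Int.emod_lt_of_pos j (by norm_num : (0 : ℤ) < 3)
  refine ⟨m, by omega, ?_⟩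
  have h0 : omega ≠ 0 := Complex.exp_ne_zero _
  have h : Complex.exp ((2 * Real.pi * j / (3 : ℕ) : ℝ) * Complex.I) = omega ^ j := by
    rw [omega, ← Complex.exp_int_mul]; congr 1; push_cast; ring
  rw [h, ← Int.mul_ediv_add_emod j 3, zpow_add₀ h0, zpow_mul, hm]
  have : omega ^ (3 : ℤ) = 1 := by exact_mod_cast omega_pow_three
  simp [this]

/-- A `G₃`-covering of the closed curves of length `2` contains unit segments. -/
theorem exists_unit_segment {K : Set ℂ}
    (hcov : IsCovering (discreteMotionGroup 3) (closedCurvesOfLength 2) K) {u : ℂ}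
    (hu : ‖u‖ = 1) : ∃ m : ℕ, m < 3 ∧ ∃ v : ℂ, v ∈ K ∧ omega ^ m * u + v ∈ K := by
  obtain ⟨g, ⟨j, v, hg⟩, hK⟩ := hcov _
    ⟨_, (lipschitzWith_doubledSegment hu).continuous.continuousOn, by norm_num,
      eVariationOn_doubledSegment hu, rfl⟩
  obtain ⟨m, hm, he⟩ := exists_omega_pow_eq j
  refine ⟨m, hm, v, hK ⟨_, ⟨0, by simp, rfl⟩, ?_⟩, hK ⟨_, ⟨1 / 2, by norm_num, rfl⟩, ?_⟩⟩
  · rw [hg]; simp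
  · rw [hg, he]; simp

theorem volume_Gamma3_le : volume Gamma3 ≤ ENNReal.ofReal (46 / 81) := by
  have hmeas : MeasurableSet Gamma3 := by
    have h1 : IsClosed Gamma3 := by
      have c : Continuous fun z : ℂ => z.im := Complex.continuous_im
      have c' : Continuous fun z : ℂ => z.re := Complex.continuous_re
      exact (isClosed_le (c.pow 2) (by fun_prop)).inter ((isClosed_le (c.pow 2) (by fun_prop)).inter
        ((isClosed_le continuous_const c).inter (isClosed_le c continuous_const)))
    exact h1.measurableSet
  rw [← Complex.volume_preserving_equiv_real_prod.symm.measure_preimage hmeas.nullMeasurableSet,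
    Measure.volume_eq_prod,
    Measure.prod_apply_symm (Complex.measurableEquivRealProd.symm.measurable hmeas)]
  have hle : ∀ y : ℝ, volume ((fun x : ℝ => (x, y)) ⁻¹'
      (Complex.measurableEquivRealProd.symm ⁻¹' Gamma3))
      ≤ (Set.Icc (0 : ℝ) (2 / 3)).indicator (fun y => ENNReal.ofReal (1 - y ^ 2)) y := by
    intro y
    by_cases hy : y ∈ Set.Icc (0 : ℝ) (2 / 3)
    · rw [Set.indicator_of_mem hy]
      calc _ ≤ volume (Set.Icc ((y ^ 2 - 1) / 2) ((1 - y ^ 2) / 2)) := by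
            refine measure_mono ?_
            rintro x ⟨h1, h2, -, -⟩
            simp only [Complex.measurableEquivRealProd_symm_apply] at h1 h2
            constructor <;> linarith
        _ = _ := by rw [Real.volume_Icc]; congr 1; ring
    · rw [Set.indicator_of_notMem hy]
      refine le_of_eq (measure_mono_null (t := ∅) ?_ measure_empty)
      rintro x ⟨-, -, h3, h4⟩
      exact (hy ⟨h3, h4⟩).elim
  refine (lintegral_mono hle).trans ?_
  rw [lintegral_indicator measurableSet_Icc, ← ofReal_integral_eq_lintegral_ofReal]
  · rw [integral_Icc_eq_integral_Ioc, ← intervalIntegral.integral_of_le (by norm_num)]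
    refine ENNReal.ofReal_le_ofReal (le_of_eq ?_)
    rw [intervalIntegral.integral_sub (by simp) (by simp), integral_pow]
    norm_num
  · exact (Continuous.continuousOn (by fun_prop)).integrableOn_Icc
  · refine (ae_restrict_iff' measurableSet_Icc).2 (.of_forall fun y hy => ?_)
    have := hy.1; have := hy.2
    simp only [Pi.zero_apply]; nlinarith

/-! ### Areas of triangles with a vertex at the origin -/

/-- The real linear map `z ↦ (re z) a + (im z) b` of the plane. -/
def planarMap (a b : ℂ) : ℂ →ₗ[ℝ] ℂ where
  toFun z := z.re * a + z.im * b
  map_add' x y := by simp; ring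
  map_smul' c x := by simp; ring

theorem det_planarMap (a b : ℂ) :
    LinearMap.det (planarMap a b) = a.re * b.im - a.im * b.re := by
  rw [← LinearMap.det_toMatrix Complex.basisOneI, Matrix.det_fin_two]
  simp [LinearMap.toMatrix_apply, planarMap]
  ring

/-- The open triangle with vertices `0`, `1`, `i`. -/
def unitTriangle : Set ℂ := {z | 0 < z.re ∧ 0 < z.im ∧ z.re + z.im < 1}

theorem isOpen_unitTriangle : IsOpen unitTriangle :=
  (isOpen_lt continuous_const Complex.continuous_re).inter
    ((isOpen_lt continuous_const Complex.continuous_im).inter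
      (isOpen_lt (Complex.continuous_re.add Complex.continuous_im) continuous_const))

theorem volume_unitTriangle : volume unitTriangle = ENNReal.ofReal (1 / 2) := by
  rw [← Complex.volume_preserving_equiv_real_prod.symm.measure_preimage
    isOpen_unitTriangle.measurableSet.nullMeasurableSet]
  have h : Complex.measurableEquivRealProd.symm ⁻¹' unitTriangle
      = regionBetween (fun _ : ℝ => 0) (fun x => 1 - x) (Set.Ioo 0 1) := by
    ext ⟨x, y⟩
    simp only [Set.mem_preimage, unitTriangle, Set.mem_ofPred_eq,
      Complex.measurableEquivRealProd_symm_apply, regionBetween, Set.mem_Ioo]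
    constructor
    · rintro ⟨h1, h2, h3⟩; exact ⟨⟨h1, by linarith⟩, h2, by linarith⟩
    · rintro ⟨⟨h1, h2⟩, h3, h4⟩; exact ⟨h1, h3, by linarith⟩
  have hc : Continuous fun x : ℝ => 1 - x := by fun_prop
  rw [h, Measure.volume_eq_prod, volume_regionBetween_eq_integral
    (continuous_const.continuousOn.integrableOn_Icc.mono_set Set.Ioo_subset_Icc_self)
    (hc.continuousOn.integrableOn_Icc.mono_set Set.Ioo_subset_Icc_self) measurableSet_Ioo
    (fun x hx => by linarith [hx.2]),
    ← integral_Ioc_eq_integral_Ioo, ← intervalIntegral.integral_of_le zero_le_one]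
  congr 1
  simp only [Pi.sub_apply, sub_zero]
  rw [intervalIntegral.integral_sub (by simp) (by simp)]
  norm_num

theorem volume_planarMap_unitTriangle (a b : ℂ) :
    volume (planarMap a b '' unitTriangle)
      = ENNReal.ofReal (|a.re * b.im - a.im * b.re| / 2) := by
  rw [Measure.addHaar_image_linearMap, det_planarMap, volume_unitTriangle,
    ← ENNReal.ofReal_mul (abs_nonneg _)]
  congr 1; ring

theorem planarMap_unitTriangle_subset {C : Set ℂ} (hC : Convex ℝ C) {a b : ℂ} (h0 : 0 ∈ C)
    (ha : a ∈ C) (hb : b ∈ C) : planarMap a b '' unitTriangle ⊆ C := by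
  rintro _ ⟨z, ⟨h1, h2, h3⟩, rfl⟩
  have h := hC.sum_mem (t := Finset.univ) (w := ![z.re, z.im, 1 - z.re - z.im]) (z := ![a, b, 0])
    (by intro i _; fin_cases i <;> simp <;> linarith)
    (by simp [Fin.sum_univ_three])
    (by intro i _; fin_cases i <;> simp [*])
  simpa [Fin.sum_univ_three, planarMap] using h

/-- The open cone spanned by `a` and `b`. -/
def openCone (a b : ℂ) : Set ℂ := {z | ∃ x y : ℝ, 0 < x ∧ 0 < y ∧ z = x * a + y * b}

theorem isOpen_planarMap_unitTriangle {a b : ℂ} (hd : a.re * b.im - a.im * b.re ≠ 0) :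
    IsOpen (planarMap a b '' unitTriangle) := by
  refine LinearMap.isOpenMap_of_finiteDimensional _ ?_ _ isOpen_unitTriangle
  rw [← det_planarMap] at hd
  exact (LinearMap.equivOfDetNeZero _ hd).surjective

theorem exists_two_triangles {C : Set ℂ} (hC : Convex ℝ C) {a b p : ℂ} {s t : ℝ} (hs : 0 < s)
    (ht : 0 < t) (hp : p = s * a + t * b) (h0 : 0 ∈ C) (ha : a ∈ C) (hb : b ∈ C) (hpC : p ∈ C)
    (hd : 0 < a.re * b.im - a.im * b.re) :
    ∃ T ⊆ C ∩ openCone a b, MeasurableSet T ∧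
      ENNReal.ofReal ((s + t) * (a.re * b.im - a.im * b.re) / 2) ≤ volume T := by
  set D := a.re * b.im - a.im * b.re with hD
  have hre : p.re = s * a.re + t * b.re := by simp [hp]
  have him : p.im = s * a.im + t * b.im := by simp [hp]
  have d1 : a.re * p.im - a.im * p.re = t * D := by rw [hre, him, hD]; ring
  have d2 : p.re * b.im - p.im * b.re = s * D := by rw [hre, him, hD]; ring
  have htD := mul_pos ht hd
  have hsD := mul_pos hs hd
  have m1 := (isOpen_planarMap_unitTriangle (d1 ▸ htD.ne')).measurableSet
  have m2 := (isOpen_planarMap_unitTriangle (d2 ▸ hsD.ne')).measurableSet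
  refine ⟨planarMap a p '' unitTriangle ∪ planarMap p b '' unitTriangle,
    Set.subset_inter (Set.union_subset (planarMap_unitTriangle_subset hC h0 ha hpC)
      (planarMap_unitTriangle_subset hC h0 hpC hb)) (Set.union_subset ?_ ?_), m1.union m2, ?_⟩
  · rintro _ ⟨z, ⟨h1, h2, -⟩, rfl⟩
    exact ⟨z.re + z.im * s, z.im * t, by positivity, by positivity, by
      simp [planarMap, hp]; ring⟩
  · rintro _ ⟨z, ⟨h1, h2, -⟩, rfl⟩
    exact ⟨z.re * s, z.re * t + z.im, by positivity, by positivity, by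
      simp [planarMap, hp]; ring⟩
  · rw [measure_union _ m2, volume_planarMap_unitTriangle, volume_planarMap_unitTriangle, d1, d2,
      abs_of_pos htD, abs_of_pos hsD, ← ENNReal.ofReal_add (by positivity) (by positivity)]
    · exact ENNReal.ofReal_le_ofReal (by linarith)
    -- The line through `0` and `p` separates the triangles: their cross products with `p` have
    -- opposite signs.
    · rw [Set.disjoint_left]
      rintro _ ⟨z, ⟨h1, h2, -⟩, rfl⟩ ⟨w, ⟨h3, h4, -⟩, h⟩
      have e1 : w.re * p.re + w.im * b.re = z.re * a.re + z.im * p.re := by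
        simpa [planarMap] using congrArg Complex.re h
      have e2 : w.re * p.im + w.im * b.im = z.re * a.im + z.im * p.im := by
        simpa [planarMap] using congrArg Complex.im h
      have e3 : z.re * (t * D) = - (w.im * (s * D)) := by
        rw [← d1, ← d2]; linear_combination p.re * e2 - p.im * e1
      have := mul_pos h1 htD
      have := mul_pos h4 hsD
      linarith

/-! ### Disjoint rotated copies -/

theorem le_volume_of_rotation {C : Set ℂ} (n : ℕ) (ρ : ℂ) (hρ : ‖ρ‖ = 1)
    (hrot : ∀ z ∈ C, ρ * z ∈ C) {S T : Set ℂ} (hT : MeasurableSet T) (hTC : T ⊆ C) (hTS : T ⊆ S)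
    (hdis : ∀ k, 0 < k → k < n → ∀ z ∈ S, ρ ^ k * z ∉ S) :
    n * volume T ≤ volume C := by
  have h0 : ρ ≠ 0 := by rintro rfl; simp at hρ
  have hpow : ∀ k : ℕ, ∀ z ∈ C, ρ ^ k * z ∈ C := by
    intro k
    induction k with
    | zero => simp
    | succ k ih => intro z hz; rw [pow_succ', mul_assoc]; exact hrot _ (ih z hz)
  set R : ℕ → Set ℂ := fun k => (fun z => (ρ ^ k)⁻¹ * z) ⁻¹' T with hR
  have hmeas : ∀ k, MeasurableSet (R k) := fun k => hT.preimage (measurable_const_mul _)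
  have hvol : ∀ k, volume (R k) = volume T := by
    intro k
    have h1 : ‖(ρ ^ k)⁻¹‖ = 1 := by simp [hρ]
    have hm := (rotation ⟨(ρ ^ k)⁻¹, by simpa [Submonoid.unitSphere] using h1⟩).measurePreserving
    exact hm.measure_preimage hT.nullMeasurableSet
  have hdisj : ∀ i j, i < j → j < n → Disjoint (R i) (R j) := by
    intro i j hij hj
    rw [Set.disjoint_left]
    intro z hi hjz
    refine hdis (j - i) (by omega) (by omega) _ (hTS hjz) ?_
    have e : ρ ^ (j - i) * ((ρ ^ j)⁻¹ * z) = (ρ ^ i)⁻¹ * z := by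
      rw [show ρ ^ j = ρ ^ i * ρ ^ (j - i) by rw [← pow_add]; congr 1; omega]
      field_simp
    simpa only [e] using hTS hi
  have hsub : ⋃ k : Fin n, R k ⊆ C := by
    refine Set.iUnion_subset fun k z hz => ?_
    have := hpow k _ (hTC hz)
    rwa [mul_inv_cancel_left₀ (pow_ne_zero _ h0)] at this
  calc n * volume T = ∑ k : Fin n, volume (R k) := by simp [hvol]
    _ = volume (⋃ k : Fin n, R k) := by
      rw [measure_iUnion _ fun k => hmeas _, tsum_fintype]
      intro i j hij
      rcases lt_or_gt_of_ne hij with h | h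
      · exact hdisj _ _ h j.2
      · exact (hdisj _ _ h i.2).symm
    _ ≤ _ := measure_mono hsub

theorem openCone_disjoint_omega {a : ℂ} (ha : a ≠ 0) (k : ℕ) (h0 : 0 < k) (h3 : k < 3) :
    ∀ z ∈ openCone a (omega * a), omega ^ k * z ∉ openCone a (omega * a) := by
  rintro _ ⟨x, y, hx, hy, rfl⟩ ⟨x', y', hx', hy', h⟩
  have h' : omega ^ k * (x + y * omega) = x' + y' * omega := by
    apply mul_right_cancel₀ ha; linear_combination h
  have hp := Real.sqrt_pos.2 (by norm_num : (0 : ℝ) < 3)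
  have hq : √3 * √3 = 3 := Real.mul_self_sqrt (by norm_num)
  rw [omega_eq] at h'
  have e1 := congrArg Complex.re h'
  have e2 := congrArg Complex.im h'
  interval_cases k
  · simp at e1 e2
    have : √3 * (x - y - y') = 0 := by linear_combination 2 * e2
    rcases mul_eq_zero.1 this with h | h <;> nlinarith
  · simp [pow_two] at e1 e2
    have : √3 * (x + y') = 0 := by linear_combination (-2) * e2 - y * √3 / 4 * hq
    rcases mul_eq_zero.1 this with h | h <;> nlinarith

theorem openCone_disjoint_I {a : ℂ} (ha : a ≠ 0) (k : ℕ) (h0 : 0 < k) (h4 : k < 4) :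
    ∀ z ∈ openCone a (Complex.I * a), Complex.I ^ k * z ∉ openCone a (Complex.I * a) := by
  rintro _ ⟨x, y, hx, hy, rfl⟩ ⟨x', y', hx', hy', h⟩
  have h' : Complex.I ^ k * (x + y * Complex.I) = x' + y' * Complex.I := by
    apply mul_right_cancel₀ ha; linear_combination h
  have e1 := congrArg Complex.re h'
  have e2 := congrArg Complex.im h'
  interval_cases k <;> simp [pow_succ] at e1 e2 <;> linarith

theorem le_volume_of_rotation_of_mem {C : Set ℂ} (hC : Convex ℝ C) (n : ℕ) {ρ a p : ℂ}
    (hρ : ‖ρ‖ = 1) (him : 0 < ρ.im) (hrot : ∀ z ∈ C, ρ * z ∈ C)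
    (hdis : ∀ k, 0 < k → k < n → ∀ z ∈ openCone a (ρ * a), ρ ^ k * z ∉ openCone a (ρ * a))
    {s t : ℝ} (hs : 0 < s) (ht : 0 < t) (hp : p = s * a + t * (ρ * a)) (h0 : 0 ∈ C)
    (ha0 : a ≠ 0) (ha : a ∈ C) (hpC : p ∈ C) :
    ENNReal.ofReal (n * ((s + t) * (‖a‖ ^ 2 * ρ.im) / 2)) ≤ volume C := by
  have e : a.re * (ρ * a).im - a.im * (ρ * a).re = ‖a‖ ^ 2 * ρ.im := by
    rw [Complex.sq_norm, Complex.normSq_apply, Complex.mul_im, Complex.mul_re]; ring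
  have hn : 0 < ‖a‖ := norm_pos_iff.2 ha0
  obtain ⟨T, hT, hm, hv⟩ := exists_two_triangles hC hs ht hp h0 ha (hrot a ha) hpC
    (by rw [e]; positivity)
  rw [e] at hv
  rw [ENNReal.ofReal_mul (by positivity), ENNReal.ofReal_natCast]
  refine le_trans (by gcongr) (le_volume_of_rotation n ρ hρ hrot hm
    (fun z hz => (hT hz).1) (fun z hz => (hT hz).2) hdis)

/-! ### Invariance under a quarter turn -/

theorem sqrt_six_le_of_sin_two_mul {x : ℝ} (hc : 0 ≤ Real.cos x) (hs : 0 ≤ Real.sin x)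
    (h : 1 / 2 ≤ Real.sin (2 * x)) : √6 ≤ 2 * (Real.cos x + Real.sin x) := by
  rw [Real.sqrt_le_iff]
  refine ⟨by positivity, ?_⟩
  rw [Real.sin_two_mul] at h
  nlinarith [Real.sin_sq_add_cos_sq x]

theorem sqrt_six_div_four_le_volume {K : Set ℂ} (hK : Convex ℝ K)
    (hrot : ∀ z ∈ K, Complex.I * z ∈ K)
    (hseg : ∀ u : ℂ, ‖u‖ = 1 → ∃ m : ℕ, m < 3 ∧ ∃ v : ℂ, v ∈ K ∧ omega ^ m * u + v ∈ K) :
    ENNReal.ofReal (√6 / 4) ≤ volume K := by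
  have hpow : ∀ k : ℕ, ∀ z ∈ K, Complex.I ^ k * z ∈ K := by
    intro k
    induction k with
    | zero => simp
    | succ k ih => intro z hz; rw [pow_succ', mul_assoc]; exact hrot _ (ih z hz)
  have hhalf : ∀ u : ℂ, ‖u‖ = 1 → ∃ m : ℕ, m < 3 ∧ omega ^ m * u / 2 ∈ K := by
    intro u hu
    obtain ⟨m, hm, v, hv, hv'⟩ := hseg u hu
    have hneg := hpow 2 v hv
    rw [Complex.I_sq] at hneg
    refine ⟨m, hm, ?_⟩
    -- The midpoint of `ω^m u + v` and `-v` no longer depends on `v`.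
    have := hK hv' hneg (a := 1 / 2) (b := 1 / 2) (by norm_num) (by norm_num) (by norm_num)
    convert this using 1
    simp only [Complex.real_smul]; push_cast; ring
  set ζ : ℂ := Complex.exp ((Real.pi / 12 : ℝ) * Complex.I) with hζ
  have hζp : ∀ d : ℕ, ζ ^ d = Complex.exp ((d * (Real.pi / 12) : ℝ) * Complex.I) := by
    intro d; rw [hζ, ← Complex.exp_nat_mul]; congr 1; push_cast; ring
  have hζn : ‖ζ‖ = 1 := Complex.norm_exp_ofReal_mul_I _
  have h8 : omega = ζ ^ 8 := by rw [hζp, omega]; congr 3; push_cast; ring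
  have h6 : Complex.I = ζ ^ 6 := by
    rw [hζp, show ((6 : ℕ) * (Real.pi / 12) : ℝ) = Real.pi / 2 by push_cast; ring,
      Complex.ofReal_div, Complex.ofReal_ofNat, Complex.exp_pi_div_two_mul_I]
  have h24 : ζ ^ 24 = 1 := by
    rw [show 24 = 6 * 4 from rfl, pow_mul, ← h6, Complex.I_pow_four]
  obtain ⟨m, hm, h1⟩ := hhalf 1 (by simp)
  obtain ⟨m', hm', h2⟩ := hhalf ζ hζn
  -- In units of `π/12`, `ω` is 8 and `I` is 6, so the angle between the two points is odd modulo 6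
  -- whatever `m`, `m'` are. The extra full turn 24 keeps `k` natural; `4 * m` stands for `-8 * m`
  -- modulo 6.
  obtain ⟨d, k, hd, hk⟩ : ∃ d k : ℕ, (d = 1 ∨ d = 3 ∨ d = 5) ∧
      6 * k + 8 * m' + 1 = 8 * m + d + 24 :=
    ⟨(8 * m' + 1 + 4 * m) % 6, (8 * m + (8 * m' + 1 + 4 * m) % 6 + 23 - 8 * m') / 6,
      by omega, by omega⟩
  set a : ℂ := omega ^ m * 1 / 2 with ha
  have han : ‖a‖ = 1 / 2 := by rw [ha, h8]; simp [hζn]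
  have ha0 : a ≠ 0 := by intro h; rw [h] at han; norm_num at han
  have hp : ζ ^ d * a ∈ K := by
    convert hpow k _ h2 using 1
    rw [ha, h8]
    rw [show Complex.I ^ k = (ζ ^ 6) ^ k by rw [← h6]]
    have : (ζ ^ 6) ^ k * ((ζ ^ 8) ^ m' * ζ / 2) = ζ ^ (6 * k + 8 * m' + 1) / 2 := by ring
    rw [this, hk, pow_add _ _ 24, h24]; ring
  set x : ℝ := d * (Real.pi / 12) with hx
  have hπ := Real.pi_pos
  have hx0 : 0 < x ∧ x < Real.pi / 2 := by
    rcases hd with rfl | rfl | rfl <;> constructor <;> simp only [hx] <;> push_cast <;> linarith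
  have hc : 0 < Real.cos x := Real.cos_pos_of_mem_Ioo ⟨by linarith, hx0.2⟩
  have hs : 0 < Real.sin x := Real.sin_pos_of_pos_of_lt_pi hx0.1 (by linarith)
  have hsin : 1 / 2 ≤ Real.sin (2 * x) := by
    rcases hd with rfl | rfl | rfl
    · rw [show 2 * x = Real.pi / 6 by rw [hx]; push_cast; ring, Real.sin_pi_div_six]
    · rw [show 2 * x = Real.pi / 2 by rw [hx]; push_cast; ring, Real.sin_pi_div_two]; norm_num
    · rw [show 2 * x = Real.pi - Real.pi / 6 by rw [hx]; push_cast; ring, Real.sin_pi_sub,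
        Real.sin_pi_div_six]
  have h0 : (0 : ℂ) ∈ K := by
    have := hK h1 (hpow 2 _ h1) (a := 1 / 2) (b := 1 / 2) (by norm_num) (by norm_num) (by norm_num)
    rw [Complex.I_sq] at this
    simpa using this
  have hv := le_volume_of_rotation_of_mem hK 4 Complex.norm_I (by simp) hrot
    (openCone_disjoint_I ha0) hc hs (p := ζ ^ d * a)
    (by rw [hζp, Complex.exp_mul_I, Complex.ofReal_cos, Complex.ofReal_sin]; ring)
    h0 ha0 h1 hp
  refine le_trans (ENNReal.ofReal_le_ofReal ?_) hv
  have := sqrt_six_le_of_sin_two_mul hc.le hs.le hsin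
  rw [han, Complex.I_im]; push_cast; linarith

/-! ### Invariance under a third of a turn -/

/-- A convex planar set other than the plane has a largest disc about the origin, with a
supporting line at a point of the disc. -/
theorem exists_inscribed_disc {K : Set ℂ} (hK : Convex ℝ K) (hint : (interior K).Nonempty)
    (h0 : 0 ∈ K) (huniv : interior K ≠ Set.univ) :
    ∃ r : ℝ, 0 ≤ r ∧ Metric.ball 0 r ⊆ K ∧ ∃ u : ℂ, ‖u‖ = 1 ∧ r * u ∈ closure K ∧
      ∀ x ∈ K, x.re * u.re + x.im * u.im ≤ r := by
  obtain ⟨q, hq, hr⟩ := isOpen_interior.isClosed_compl.exists_infDist_eq_dist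
    (Set.nonempty_compl.2 huniv) (0 : ℂ)
  have hball : Metric.ball 0 ‖q‖ ⊆ interior K := by
    rw [← dist_zero_left, ← hr]; exact Metric.ball_infDist_compl_subset
  obtain ⟨f, hf⟩ := geometric_hahn_banach_open_point hK.interior isOpen_interior hq
  have hfx : ∀ x : ℂ, f x = x.re * f 1 + x.im * f Complex.I := by
    intro x
    conv_lhs => rw [show x = x.re • (1 : ℂ) + x.im • Complex.I by simp [Complex.re_add_im]]
    rw [map_add, map_smul, map_smul, smul_eq_mul, smul_eq_mul]
  set w : ℂ := ⟨f 1, f Complex.I⟩ with hw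
  have hw0 : w ≠ 0 := by
    intro h
    obtain ⟨y, hy⟩ := hint
    have h1 : f 1 = 0 := congrArg Complex.re h
    have h2 : f Complex.I = 0 := congrArg Complex.im h
    have := hf y hy
    rw [hfx, hfx q, h1, h2] at this
    simp at this
  have hwn : 0 < ‖w‖ := norm_pos_iff.2 hw0
  set u : ℂ := ((‖w‖⁻¹ : ℝ) : ℂ) * w with hu
  have hun : ‖u‖ = 1 := by
    rw [hu, norm_mul, Complex.norm_real, norm_inv, norm_norm, inv_mul_cancel₀ hwn.ne']
  have hfu : ∀ x : ℂ, x.re * u.re + x.im * u.im = ‖w‖⁻¹ * f x := by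
    intro x; rw [hfx, hu, Complex.re_ofReal_mul, Complex.im_ofReal_mul]; simp only [hw]; ring
  have hK' : ∀ x ∈ K, f x ≤ f q := by
    intro x hx
    have hcl : closure (interior K) ⊆ {x | f x ≤ f q} :=
      closure_minimal (fun y hy => (hf y hy).le) (isClosed_le f.continuous continuous_const)
    rw [hK.closure_interior_eq_closure_of_nonempty_interior hint] at hcl
    exact hcl (subset_closure hx)
  have hu2 : u.re ^ 2 + u.im ^ 2 = 1 := by
    have := Complex.sq_norm u
    rw [hun, Complex.normSq_apply] at this; linarith
  have hq2 : q.re ^ 2 + q.im ^ 2 = ‖q‖ ^ 2 := by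
    rw [Complex.sq_norm, Complex.normSq_apply]; ring
  have hCS : q.re * u.re + q.im * u.im ≤ ‖q‖ := by
    refine abs_le_of_sq_le_sq' ?_ (norm_nonneg q) |>.2
    rw [← hq2]
    nlinarith [sq_nonneg (q.re * u.im - q.im * u.re)]
  have hle : ∀ x ∈ K, x.re * u.re + x.im * u.im ≤ q.re * u.re + q.im * u.im := by
    intro x hx
    rw [hfu, hfu]
    exact mul_le_mul_of_nonneg_left (hK' x hx) (by positivity)
  have hge : ‖q‖ ≤ q.re * u.re + q.im * u.im := by
    rcases (norm_nonneg q).eq_or_lt with h | h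
    · rw [← h]; simpa using hle 0 h0
    -- The points `t u` with `0 ≤ t < ‖q‖` lie in the disc; let `t` tend to `‖q‖`.
    · refine le_of_forall_lt_imp_le_of_dense fun t ht => ?_
      rcases lt_or_ge t 0 with h' | h'
      · exact h'.le.trans (by simpa using hle 0 h0)
      · have := hle (t * u) (interior_subset (hball (by simpa [hun, abs_of_nonneg h'] using ht)))
        rw [Complex.re_ofReal_mul, Complex.im_ofReal_mul] at this
        nlinarith
  have hqu : ‖q‖ * u = q := by
    have h1 : (q.re - ‖q‖ * u.re) ^ 2 + (q.im - ‖q‖ * u.im) ^ 2 ≤ 0 := by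
      nlinarith [mul_le_mul_of_nonneg_left hge (norm_nonneg q)]
    apply Complex.ext
    · rw [Complex.re_ofReal_mul]
      nlinarith [sq_nonneg (q.re - ‖q‖ * u.re), sq_nonneg (q.im - ‖q‖ * u.im)]
    · rw [Complex.im_ofReal_mul]
      nlinarith [sq_nonneg (q.re - ‖q‖ * u.re), sq_nonneg (q.im - ‖q‖ * u.im)]
  refine ⟨‖q‖, norm_nonneg q, hball.trans interior_subset, u, hun, ?_,
    fun x hx => (hle x hx).trans hCS⟩
  rw [hqu]
  by_cases h : q = 0
  · rw [h]; exact subset_closure h0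
  · refine closure_mono (hball.trans interior_subset) ?_
    rw [closure_ball _ (norm_ne_zero_iff.2 h)]
    simp

theorem sqrt_three_div_three_le : √3 / 3 ≤ 3 / 4 := by
  have : √3 ≤ 2 := Real.sqrt_le_iff.2 ⟨by norm_num, by norm_num⟩
  linarith

theorem sqrt_three_div_three_le_volume {K : Set ℂ} (hK : Convex ℝ K)
    (hrot : ∀ z ∈ K, omega * z ∈ K)
    (hseg : ∀ u : ℂ, ‖u‖ = 1 → ∃ v : ℂ, v ∈ K ∧ u + v ∈ K) :
    ENNReal.ofReal (√3 / 3) ≤ volume K := by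
  have h3 : √3 * √3 = 3 := Real.mul_self_sqrt (by norm_num)
  have h3p : 0 < √3 := Real.sqrt_pos.2 (by norm_num)
  have hωn : ‖omega‖ = 1 := Complex.norm_exp_ofReal_mul_I _
  have hωre : omega.re = -1 / 2 := by rw [omega_eq]
  have hωim : omega.im = √3 / 2 := by rw [omega_eq]
  have hω2 : omega * omega = -1 - omega := by
    apply Complex.ext
    · rw [Complex.mul_re, Complex.sub_re, hωre, hωim, Complex.neg_re, Complex.one_re]; linarith
    · rw [Complex.mul_im, Complex.sub_im, hωre, hωim, Complex.neg_im, Complex.one_im]; linarith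
  obtain ⟨v, hvK, hv0⟩ : ∃ v ∈ K, v ≠ 0 := by
    obtain ⟨v, h1, h2⟩ := hseg 1 (by simp)
    by_cases h : v = 0
    · exact ⟨_, h2, by simp [h]⟩
    · exact ⟨v, h1, h⟩
  have h0 : (0 : ℂ) ∈ K := by
    have h := hK.sum_mem (t := Finset.univ) (w := fun _ => 1 / 3)
      (z := ![v, omega * v, omega * (omega * v)])
      (by intro i _; norm_num) (by simp)
      (by intro i _; fin_cases i <;> simp [hvK, hrot])
    have e : v + omega * v + omega * (omega * v) = 0 := by linear_combination v * hω2
    rw [← Finset.smul_sum, Fin.sum_univ_three] at h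
    simpa [e] using h
  have hint : (interior K).Nonempty := by
    have hd : v.re * (omega * v).im - v.im * (omega * v).re ≠ 0 := by
      have e : v.re * (omega * v).im - v.im * (omega * v).re = ‖v‖ ^ 2 * omega.im := by
        rw [Complex.sq_norm, Complex.normSq_apply, Complex.mul_im, Complex.mul_re]; ring
      have := norm_pos_iff.2 hv0
      rw [e, hωim]; positivity
    refine Set.Nonempty.mono (interior_maximal
      (planarMap_unitTriangle_subset hK h0 hvK (hrot v hvK)) (isOpen_planarMap_unitTriangle hd))
      (Set.Nonempty.image _ ⟨⟨1 / 4, 1 / 4⟩, ?_⟩)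
    refine ⟨?_, ?_, ?_⟩ <;> norm_num
  by_cases huniv : interior K = Set.univ
  · have : K = Set.univ := Set.univ_subset_iff.1 (huniv ▸ interior_subset)
    rw [this, measure_univ_of_isAddLeftInvariant]; exact le_top
  obtain ⟨r, hr, hball, u, hu, hru, hsupp⟩ := exists_inscribed_disc hK hint h0 huniv
  rcases le_or_gt (1 / 2) r with hr2 | hr2
  · calc ENNReal.ofReal (√3 / 3) ≤ ENNReal.ofReal ((1 / 2) ^ 2 * Real.pi) := by
          refine ENNReal.ofReal_le_ofReal ?_
          have := sqrt_three_div_three_le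
          have := Real.pi_gt_three
          linarith
      _ = volume (Metric.ball (0 : ℂ) (1 / 2)) := by
          rw [Complex.volume_ball, ENNReal.ofReal_mul (by norm_num),
            ENNReal.ofReal_pow (by norm_num)]
          congr 1
          rw [← NNReal.coe_real_pi, ENNReal.ofReal_coe_nnreal]
      _ ≤ volume K := measure_mono ((Metric.ball_subset_ball hr2).trans hball)
  obtain ⟨p, hp, hup⟩ := hseg u hu
  have hu2 : u.re ^ 2 + u.im ^ 2 = 1 := by
    have := Complex.sq_norm u
    rw [hu, Complex.normSq_apply] at this; linarith
  set x : ℝ := p.re * u.re + p.im * u.im with hx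
  set y : ℝ := p.im * u.re - p.re * u.im with hy
  have hxr : x + 1 ≤ r := by
    have := hsupp _ hup
    rw [Complex.add_re, Complex.add_im] at this
    linarith
  have c1 : -x / 2 - √3 / 2 * y ≤ r := by
    have := hsupp _ (hrot p hp)
    rw [Complex.mul_re, Complex.mul_im, hωre, hωim] at this
    linarith
  have c2 : -x / 2 + √3 / 2 * y ≤ r := by
    have := hsupp _ (hrot _ (hrot p hp))
    rw [← mul_assoc, hω2, Complex.mul_re, Complex.mul_im, Complex.sub_re, Complex.sub_im, hωre,
      hωim, Complex.neg_re, Complex.neg_im, Complex.one_re, Complex.one_im] at this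
    linarith
  -- Adding `c1` and `c2` gives `-x ≤ 2r`, while `hxr` gives `1 - r ≤ -x`.
  have hr3 : 1 / 3 ≤ r := by linarith
  have hrp : 0 < r := by linarith
  have hpu : p = (x + y * Complex.I) * u := by
    apply Complex.ext
    · simp [hx, hy]; linear_combination (-p.re) * hu2
    · simp [hx, hy]; linear_combination (-p.im) * hu2
  have hrotC : ∀ z ∈ closure K, omega * z ∈ closure K := fun z hz =>
    map_mem_closure (continuous_const_mul omega) hz hrot
  have ha : omega * (r * u) ∈ closure K := hrotC _ hru
  have han : ‖omega * (r * u)‖ = r := by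
    rw [norm_mul, norm_mul, hωn, hu, Complex.norm_real, Real.norm_of_nonneg hr]; ring
  have ha0 : omega * (r * u) ≠ 0 := by intro h; rw [h, norm_zero] at han; linarith
  -- Coordinates of `p` in the basis `ωru`, `ω²ru`; positive by `c1`, `c2`, `hxr` and `r < 1/2`.
  have hs : 0 < (-x + √3 * y / 3) / r := div_pos (by linarith) hrp
  have ht : 0 < (-x - √3 * y / 3) / r := div_pos (by linarith) hrp
  have hv := le_volume_of_rotation_of_mem hK.closure 3 hωn (by rw [hωim]; positivity) hrotC
    (openCone_disjoint_omega ha0) hs ht (p := p) (by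
      have hrc : (r : ℂ) ≠ 0 := by exact_mod_cast hrp.ne'
      have hI : (x : ℂ) + y * Complex.I
          = (-x + √3 * y / 3 : ℝ) * omega + (-x - √3 * y / 3 : ℝ) * (-1 - omega) := by
        apply Complex.ext
        · simp [hωre]; ring
        · simp [hωim]; linear_combination (-y / 3) * h3
      rw [hpu, hI, ← hω2]
      push_cast
      field_simp) (subset_closure h0) ha0 ha (subset_closure hp)
  -- The contact point need only lie in `closure K`, which has the same area by convexity.
  have hcl : volume (closure K) = volume K :=
    measure_closure_of_null_frontier (hK.addHaar_frontier volume)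
  rw [hcl] at hv
  refine le_trans (ENNReal.ofReal_le_ofReal ?_) hv
  rw [han, hωim, ← add_div]
  have e : ((3 : ℕ) : ℝ) * ((-x + √3 * y / 3 + (-x - √3 * y / 3)) / r * (r ^ 2 * (√3 / 2)) / 2)
      = √3 * (3 / 2 * (-x * r)) := by push_cast; field_simp; ring
  rw [e, div_eq_mul_inv]
  refine mul_le_mul_of_nonneg_left ?_ h3p.le
  nlinarith [mul_le_mul_of_nonneg_right (by linarith : 1 - r ≤ -x) hr,
    mul_nonneg (by linarith : 0 ≤ r - 1 / 3) (by linarith : 0 ≤ 2 / 3 - r)]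

theorem volume_Gamma3_lt {A : ℝ} (h : 46 / 81 < A) {K : Set ℂ}
    (hK : ENNReal.ofReal A ≤ volume K) : volume Gamma3 < volume K :=
  (volume_Gamma3_le.trans_lt ((ENNReal.ofReal_lt_ofReal_iff (by linarith)).2 h)).trans_le hK

end PlanarArea

theorem mainTheorem9 (K : Set ℂ) (hconv : Convex ℝ K)
    (hcov : IsCovering (discreteMotionGroup 3) (closedCurvesOfLength 2) K) :
    (IsRegularUnderRotation (2 * Real.pi / 3) K →
      ENNReal.ofReal (√3 / 3) ≤ MeasureTheory.volume K ∧
        MeasureTheory.volume Gamma3 < MeasureTheory.volume K) ∧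
    (IsRegularUnderRotation (Real.pi / 2) K →
      ENNReal.ofReal (√6 / 4) ≤ MeasureTheory.volume K ∧
        MeasureTheory.volume Gamma3 < MeasureTheory.volume K) := by
  have hseg : ∀ c u : ℂ, ‖u‖ = 1 → ∃ m : ℕ, m < 3 ∧
      ∃ v : ℂ, v ∈ (fun z => c + z) ⁻¹' K ∧ omega ^ m * u + v ∈ (fun z => c + z) ⁻¹' K := by
    intro c u hu
    obtain ⟨m, hm, v, h1, h2⟩ := exists_unit_segment hcov hu
    exact ⟨m, hm, v - c, by simpa using h1,
      by simpa [show c + (omega ^ m * u + (v - c)) = omega ^ m * u + v by ring] using h2⟩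
  have hrot : ∀ (c : ℂ) (θ : ℝ),
      (fun z : ℂ => c + Complex.exp (θ * Complex.I) * (z - c)) '' K = K →
      ∀ z ∈ (fun z => c + z) ⁻¹' K, Complex.exp (θ * Complex.I) * z ∈ (fun z => c + z) ⁻¹' K := by
    intro c θ h z hz
    rw [Set.mem_preimage, ← h]
    exact ⟨c + z, hz, by simp⟩
  constructor
  · rintro ⟨c, hc⟩
    have hr : ∀ z ∈ (fun z => c + z) ⁻¹' K, omega * z ∈ (fun z => c + z) ⁻¹' K := hrot c _ hc
    have hpow : ∀ k : ℕ, ∀ z ∈ (fun z => c + z) ⁻¹' K,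
        omega ^ k * z ∈ (fun z => c + z) ⁻¹' K := by
      intro k
      induction k with
      | zero => simp
      | succ k ih => intro z hz; rw [pow_succ', mul_assoc]; exact hr _ (ih z hz)
    have h := sqrt_three_div_three_le_volume (hconv.translate_preimage_right c) hr
      fun u hu => by
        obtain ⟨m, hm, v, h1, h2⟩ := hseg c u hu
        -- Rotating by `ω^(3 - m)` undoes the unknown rotation `ω^m`.
        refine ⟨omega ^ (3 - m) * v, hpow _ _ h1, ?_⟩
        have h' := hpow (3 - m) _ h2
        rwa [mul_add, ← mul_assoc, ← pow_add, Nat.sub_add_cancel hm.le, omega_pow_three,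
          one_mul] at h'
    rw [MeasureTheory.measure_preimage_add] at h
    have : (46 : ℝ) / 27 < √3 := Real.lt_sqrt_of_sq_lt (by norm_num)
    exact ⟨h, volume_Gamma3_lt (by linarith) h⟩
  · rintro ⟨c, hc⟩
    have hI : Complex.exp ((Real.pi / 2 : ℝ) * Complex.I) = Complex.I := by
      rw [Complex.ofReal_div, Complex.ofReal_ofNat, Complex.exp_pi_div_two_mul_I]
    have hr := hrot c _ hc
    rw [hI] at hr
    have h := sqrt_six_div_four_le_volume (hconv.translate_preimage_right c) hr (hseg c)
    rw [MeasureTheory.measure_preimage_add] at h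
    have : (184 : ℝ) / 81 < √6 := Real.lt_sqrt_of_sq_lt (by norm_num)
    exact ⟨h, volume_Gamma3_lt (by linarith) h⟩
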